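/- **Setting.** Let $I$ be a set (the main case is $I=\mathbb N$). Let $V$ be the complex vector space with basis the non-empty words $w=i_1\cdots i_n$ in the alphabet $I$, and let $T(V)=\bigoplus_{n\ge 0}V^{\otimes n}$ be its tensor algebra, with product written $w_1|w_2$ and unit $\mathbf 1$, which is identified with the empty word. For $w=a_1\cdots a_n$ and $S\subseteq[n]$ let $w_S$ be the subword of $w$ on the positions in $S$, and let $J^S_1,\dots,J^S_m$ be the maximal intervals of $[n]\setminus S$, from left to right. Put $$\Delta(w)=\sum_{S\subseteq[n]} w_S\otimes w_{J_1^S}|\cdots|w_{J_m^S},$$ and let $\Delta_\prec(w)$ and $\Delta_\succ(w)$ be the partial sums over the $S$ with $1\in S$ and with $1\notin S$, respectively. Extend $\Delta$ multiplicatively to $T(V)\to T(V)\otimes T(V)$, and extend the other two by $\Delta_\bullet(w_1|w_2|\cdots|w_n)=\Delta_\bullet(w_1)\,\Delta(w_2|\cdots|w_n)$ for $n\geq 1$ and $\Delta_\bullet(\mathbf 1)=0$, where $\bullet\in\{\prec,\succ\}$. For linear forms $\mu,\nu$ on $T(V)$ let $\mu*\nu=m(\mu\otimes\nu)\Delta$,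 $\mu\prec\nu=m(\mu\otimes\nu)\Delta_\prec$ and $\mu\succ\nu=m(\mu\otimes\nu)\Delta_\succ$, where $m$ is the product of $\mathbb C$. Let $\varepsilon:T(V)\to\mathbb C$ be the projection onto $V^{\otimes 0}=\mathbb C$. A linear form is an infinitesimal character if it vanishes on $\mathbf 1$ and on $V^{\otimes n}$ for all $n\ge2$; a character is a morphism of unital algebras $T(V)\to\mathbb C$. For a linear form $\mu$ on $T(V)$ let $\widehat\mu(x)=\mu(\mathbf 1)+\sum_{w}\mu(w)\,x_w\in\mathbb C\langle\langle x_i: i\in I\rangle\rangle$ (the sum is over the non-empty words, and $x_{i_1\cdots i_k}=x_{i_1}\cdots x_{i_k}$), a formal power series in non-commuting variables. For such series $f=\sum_w f_wx_w$ and $g$ let $f(xg(x))$ be the series obtained from $f$ by substituting $x_i\,g(x)$ for every $x_i$. Let $(B,\varphi)$ be a non-commutative probability space: a unital associative $\mathbb C$-algebra $B$ with a linear form $\varphi$ such that $\varphi(1)=1$. Let $(b_i)_{i\in I}$ be a family of elements of $B$, and let $\Phi:T(V)\to\mathbb C$ be the character with $\Phi(i_1\cdots i_k)=\varphi(b_{i_1}\cdots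 b_{i_k})$ for every non-empty word. **Proposition.** The form $\Phi$ has a unique two-sided inverse $\Phi^{-1}$ for the convolution $*$ (whose unit is $\varepsilon$), and it is a character. There are unique infinitesimal characters $\kappa$ (the free cumulants) and $\beta$ (the Boolean cumulants) such that $$\Phi=\varepsilon+\kappa\prec\Phi,\qquad \Phi=\varepsilon+\Phi\succ\beta.$$ Moreover: (i) $\displaystyle\widehat{\Phi^{-1}}(x)=\frac1{1+\widehat\kappa(x)}$, that is, $\widehat{\Phi^{-1}}$ is the two-sided multiplicative inverse of $1+\widehat\kappa$ in $\mathbb C\langle\langle x_i:i\in I\rangle\rangle$; (ii) $\displaystyle\widehat\beta(x)=1-\widehat{\Phi^{-1}}\big(x\,\widehat\Phi(x)\big)$. -/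

import Mathlib

open scoped TensorProduct

noncomputable section

/-! ## Formal power series in non-commuting variables -/

/-- The set `A⟨⟨x_i : i ∈ ι⟩⟩` of formal power series in non-commuting variables `x_i`: such a
series is the family of its coefficients `f_w`, indexed by the words `w` in the alphabet `ι`
(the empty word `[]` included). -/
def NCPowerSeries (ι : Type*) (A : Type*) : Type _ := List ι → A

namespace NCPowerSeries

variable {ι : Type*} {A : Type*}

@[ext] theorem ext {f g : NCPowerSeries ι A} (h : ∀ w, f w = g w) : f = g := funext h

variable [CommRing A]

instance : AddCommGroup (NCPowerSeries ι A) := inferInstanceAs (AddCommGroup (List ι → A))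

/-- The constant series `1`. -/
instance : One (NCPowerSeries ι A) := ⟨fun w => if w.isEmpty then 1 else 0⟩

/-- The Cauchy product: `(fg)_w` is the sum of `f_u g_v` over all ways of cutting the word `w`
into `w = uv`, where `u` or `v` may be empty. -/
instance : Mul (NCPowerSeries ι A) :=
  ⟨fun f g w => ∑ j ∈ Finset.range (w.length + 1), f (w.take j) * g (w.drop j)⟩

theorem add_apply (f g : NCPowerSeries ι A) (w : List ι) : (f + g) w = f w + g w := rfl

theorem zero_apply (w : List ι) : (0 : NCPowerSeries ι A) w = 0 := rfl

theorem one_nil : (1 : NCPowerSeries ι A) [] = 1 := rfl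

theorem one_cons (a : ι) (w : List ι) : (1 : NCPowerSeries ι A) (a :: w) = 0 := rfl

theorem mul_apply (f g : NCPowerSeries ι A) (w : List ι) :
    (f * g) w = ∑ j ∈ Finset.range (w.length + 1), f (w.take j) * g (w.drop j) := rfl

theorem mul_nil (f g : NCPowerSeries ι A) : (f * g) [] = f [] * g [] := by
  simp [mul_apply]

/-- The series with coefficients `f_{aw}`. -/
def shift (a : ι) (f : NCPowerSeries ι A) : NCPowerSeries ι A := fun w => f (a :: w)

theorem mul_cons (f g : NCPowerSeries ι A) (a : ι) (w : List ι) :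
    (f * g) (a :: w) = f [] * g (a :: w) + (shift a f * g) w := by
  rw [mul_apply, mul_apply, List.length_cons, Finset.sum_range_succ']
  simp [shift, add_comm]

protected theorem add_mul' (f g h : NCPowerSeries ι A) : (f + g) * h = f * h + g * h := by
  ext w
  simp only [mul_apply, add_apply, add_mul, Finset.sum_add_distrib]

protected theorem mul_add' (f g h : NCPowerSeries ι A) : f * (g + h) = f * g + f * h := by
  ext w
  simp only [mul_apply, add_apply, mul_add, Finset.sum_add_distrib]

protected theorem zero_mul' (f : NCPowerSeries ι A) : 0 * f = 0 := by
  ext w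
  simp [mul_apply, zero_apply]

protected theorem mul_zero' (f : NCPowerSeries ι A) : f * 0 = 0 := by
  ext w
  simp [mul_apply, zero_apply]

protected theorem one_mul' (f : NCPowerSeries ι A) : 1 * f = f := by
  ext w
  cases w with
  | nil => simp [mul_nil, one_nil]
  | cons a w =>
    have h : shift a (1 : NCPowerSeries ι A) = 0 := rfl
    rw [mul_cons, h, NCPowerSeries.zero_mul', one_nil, zero_apply]
    simp

protected theorem mul_one' (f : NCPowerSeries ι A) : f * 1 = f := by
  ext w
  induction w generalizing f with
  | nil => simp [mul_nil, one_nil]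
  | cons a w ih =>
    rw [mul_cons, one_cons, ih]
    simp [shift]

theorem shift_mul_mul (c : A) (p q h : NCPowerSeries ι A) (w : List ι) :
    ((show NCPowerSeries ι A from fun v => c * p v + q v) * h) w = c * (p * h) w + (q * h) w := by
  simp only [mul_apply, Finset.mul_sum, ← Finset.sum_add_distrib]
  refine Finset.sum_congr rfl fun j _ => ?_
  ring

protected theorem mul_assoc' (f g h : NCPowerSeries ι A) : f * g * h = f * (g * h) := by
  ext w
  induction w generalizing f with
  | nil => simp only [mul_nil, mul_assoc]
  | cons a w ih =>
    have e : shift a (f * g) =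
        (show NCPowerSeries ι A from fun v => f [] * shift a g v + (shift a f * g) v) := by
      ext v
      exact mul_cons f g a v
    rw [mul_cons, e, shift_mul_mul, ih, mul_nil, mul_cons f, mul_cons g]
    ring

/-- The ring of formal power series in non-commuting variables, with the Cauchy product. -/
instance : Ring (NCPowerSeries ι A) :=
  { (inferInstance : AddCommGroup (NCPowerSeries ι A)) with
    one := 1
    mul := (· * ·)
    left_distrib := NCPowerSeries.mul_add'
    right_distrib := NCPowerSeries.add_mul'
    zero_mul := NCPowerSeries.zero_mul'
    mul_zero := NCPowerSeries.mul_zero'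
    mul_assoc := NCPowerSeries.mul_assoc'
    one_mul := NCPowerSeries.one_mul'
    mul_one := NCPowerSeries.mul_one' }

open Classical in
/-- The variable `x_i`. -/
def X (i : ι) : NCPowerSeries ι A := fun w => if w = [i] then 1 else 0

/-- Substitution `f(y) = ∑_v f_v y_v` of a family `y` of series for the variables, where
`y_v = y_{i_1} ⋯ y_{i_k}` for the word `v = i_1 ⋯ i_k`, computed coefficientwise. It is meaningful
when every word occurs in `y_v` for only finitely many `v`; for the families used below this is
`finite_support_shifted`. -/
def subst (y : ι → NCPowerSeries ι A) (f : NCPowerSeries ι A) : NCPowerSeries ι A :=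
  fun w => ∑ᶠ v : List ι, f v * (v.map y).prod w

/-- The transformed variables `xg(x)`, that is, `(xg(x))_i = x_i g(x)`. -/
def shiftedVars (g : NCPowerSeries ι A) : ι → NCPowerSeries ι A := fun i => X i * g

theorem shift_X_mul_ne (a i : ι) (h : a ≠ i) (g : NCPowerSeries ι A) : 
    shift a (X i * g) = 0 := by
  have e : shift a (X i : NCPowerSeries ι A) = 0 := by
    ext w
    simp [shift, X, h, zero_apply]
  ext w
  change (X i * g : NCPowerSeries ι A) (a :: w) = 0
  rw [mul_cons, e, zero_mul, zero_apply]
  simp [X]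

/-- A word can occur in `(xg(x))_v` only if it contains `v` as a scattered subword. -/
theorem sublist_of_shifted_ne_zero (g : NCPowerSeries ι A) (v w : List ι)
    (h : (v.map (shiftedVars g)).prod w ≠ 0) : v.Sublist w := by
  induction v generalizing w with
  | nil => simp
  | cons i v ih =>
    rw [List.map_cons, List.prod_cons] at h
    cases w with
    | nil =>
      exact absurd (by simp [shiftedVars, mul_nil, X]) h
    | cons a w =>
      have h0 : (shiftedVars g i) [] = 0 := by simp [shiftedVars, mul_nil, X]
      rw [mul_cons, h0, zero_mul, zero_add] at h
      by_cases hai : a = i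
      · subst hai
        refine List.Sublist.cons_cons a ?_
        rw [mul_apply] at h
        obtain ⟨j, -, hj⟩ := Finset.exists_ne_zero_of_sum_ne_zero h
        exact (ih _ (right_ne_zero_of_mul hj)).trans (List.drop_sublist j w)
      · exfalso
        apply h
        have := shift_X_mul_ne a i hai g
        rw [shiftedVars, this, zero_mul, zero_apply]

/-- The sums that define the coefficients of `f(xg(x))` are finite. -/
theorem finite_support_shifted (f g : NCPowerSeries ι A) (w : List ι) :
    (Function.support fun v : List ι => f v * (v.map (shiftedVars g)).prod w).Finite := by
  refine (List.finite_toSet w.sublists).subset fun v hv => ?_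
  exact List.mem_sublists.2 (sublist_of_shifted_ne_zero g v w (right_ne_zero_of_mul hv))

end NCPowerSeries

/-! ## The Hopf algebra of words -/

namespace WordHopf

variable {ι : Type*}

/-- The vector space `V` with basis the non-empty words in the alphabet `ι`. -/
abbrev V (ι : Type*) : Type _ := FreeSemigroup ι →₀ ℂ

/-- The tensor algebra `T(V)`, with product `|`. -/
abbrev TV (ι : Type*) : Type _ := TensorAlgebra ℂ (V ι)

/-- The element of `T(V)` given by a word; the empty word is the unit of `T(V)`. -/
def ofWord : List ι → TV ι
  | [] => 1
  | a :: l => TensorAlgebra.ι ℂ (Finsupp.single ⟨a, l⟩ 1)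

/-- The number of letters of a non-empty word, in the form `_ + 1`. -/
abbrev len (w : FreeSemigroup ι) : ℕ := w.tail.length + 1

/-- The `j`-th letter of a non-empty word. -/
def letter (w : FreeSemigroup ι) (j : Fin (len w)) : ι := (w.head :: w.tail).get j

/-- The maximal intervals `J_1, …, J_m` of the complement of `S` in `{0, …, n - 1}`, from left to
right, each listed in increasing order. -/
def gaps {n : ℕ} (S : Finset (Fin n)) : List (List (Fin n)) :=
  ((List.finRange n).splitOnP (· ∈ S)).filter (fun J => !J.isEmpty)

/-- The term `w_S ⊗ w_{J_1} | ⋯ | w_{J_m}` of the coproduct of the word `w`. -/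
def coprodTerm (w : FreeSemigroup ι) (S : Finset (Fin (len w))) : TV ι ⊗[ℂ] TV ι :=
  ofWord (((List.finRange (len w)).filter (· ∈ S)).map (letter w)) ⊗ₜ[ℂ]
    ((gaps S).map fun J => ofWord (J.map (letter w))).prod

/-- The coproduct `Δ : V → T(V) ⊗ T(V)`. -/
def coprodV : V ι →ₗ[ℂ] TV ι ⊗[ℂ] TV ι :=
  Finsupp.linearCombination ℂ fun w => ∑ S : Finset (Fin (len w)), coprodTerm w S

/-- The coproduct `Δ` of `T(V)`, the multiplicative extension of `coprodV`. -/
def coprod : TV ι →ₐ[ℂ] TV ι ⊗[ℂ] TV ι := TensorAlgebra.lift ℂ coprodV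

/-- The left half-coproduct on `V`: the terms of `Δ` in which `S` contains the first position
(`S` everything gives the term `w ⊗ 1`). -/
def coprodLeftV : V ι →ₗ[ℂ] TV ι ⊗[ℂ] TV ι :=
  Finsupp.linearCombination ℂ fun w =>
    ∑ S : Finset (Fin (len w)) with (0 : Fin (len w)) ∈ S, coprodTerm w S

/-- The right half-coproduct on `V`: the terms of `Δ` in which `S` does not contain the first
position (`S` empty gives the term `1 ⊗ w`). -/
def coprodRightV : V ι →ₗ[ℂ] TV ι ⊗[ℂ] TV ι :=
  Finsupp.linearCombination ℂ fun w =>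
    ∑ S : Finset (Fin (len w)) with (0 : Fin (len w)) ∉ S, coprodTerm w S

/-- Auxiliary algebra morphism `v ↦ [[0, δ v], [0, Δ v]]`; its upper right entry is the extension
of `δ` to `T(V)` described in `halfExtend`. -/
def halfMatrix (δ : V ι →ₗ[ℂ] TV ι ⊗[ℂ] TV ι) :
    TV ι →ₐ[ℂ] Matrix (Fin 2) (Fin 2) (TV ι ⊗[ℂ] TV ι) :=
  TensorAlgebra.lift ℂ
    (Matrix.singleLinearMap ℂ (0 : Fin 2) (1 : Fin 2) ∘ₗ δ +
      Matrix.singleLinearMap ℂ (1 : Fin 2) (1 : Fin 2) ∘ₗ coprodV)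

/-- The extension of a half-coproduct `δ` from `V` to `T(V)`, determined by
`w_1 | w_2 | ⋯ | w_n ↦ δ(w_1) Δ(w_2 | ⋯ | w_n)` for `n ≥ 1`, and by `1 ↦ 0`; see `halfExtend_one`
and `halfExtend_mul`. -/
def halfExtend (δ : V ι →ₗ[ℂ] TV ι ⊗[ℂ] TV ι) : TV ι →ₗ[ℂ] TV ι ⊗[ℂ] TV ι where
  toFun t := halfMatrix δ t 0 1
  map_add' s t := by simp
  map_smul' c t := by simp

theorem halfExtend_one (δ : V ι →ₗ[ℂ] TV ι ⊗[ℂ] TV ι) : halfExtend δ 1 = 0 := by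
  simp [halfExtend]

theorem halfMatrix_lower (δ : V ι →ₗ[ℂ] TV ι ⊗[ℂ] TV ι) (t : TV ι) :
    halfMatrix δ t 1 0 = 0 ∧ halfMatrix δ t 1 1 = coprod t := by
  induction t using TensorAlgebra.induction with
  | algebraMap r => simp [Matrix.algebraMap_matrix_apply]
  | ι v => simp [halfMatrix, coprod, Matrix.single]
  | mul a b ha hb => simp [Matrix.mul_apply, Fin.sum_univ_two, ha, hb]
  | add a b ha hb => simp [ha, hb]

theorem halfExtend_mul (δ : V ι →ₗ[ℂ] TV ι ⊗[ℂ] TV ι) (v : V ι) (t : TV ι) :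
    halfExtend δ (TensorAlgebra.ι ℂ v * t) = δ v * coprod t := by
  have h : halfMatrix δ (TensorAlgebra.ι ℂ v) 0 0 = 0 := by
    simp [halfMatrix, Matrix.single]
  have h' : halfMatrix δ (TensorAlgebra.ι ℂ v) 0 1 = δ v := by
    simp [halfMatrix, Matrix.single]
  simp [halfExtend, Matrix.mul_apply, Fin.sum_univ_two, h, h', (halfMatrix_lower δ t).2]

/-- The product `m ∘ (φ ⊗ ψ) ∘ D` of linear forms that is dual to a map `D`. -/
def dualProd (D : TV ι →ₗ[ℂ] TV ι ⊗[ℂ] TV ι) (φ ψ : TV ι →ₗ[ℂ] ℂ) : TV ι →ₗ[ℂ] ℂ :=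
  LinearMap.mul' ℂ ℂ ∘ₗ TensorProduct.map φ ψ ∘ₗ D

/-- The convolution product `φ * ψ` of linear forms on `T(V)`. -/
def conv (φ ψ : TV ι →ₗ[ℂ] ℂ) : TV ι →ₗ[ℂ] ℂ := dualProd coprod.toLinearMap φ ψ

/-- The left half-shuffle product `φ ≺ ψ`. The value on `1` is `0`, and the same formula gives
`φ ≺ ε = φ` and `ε ≺ φ = 0` for every form `φ` with `φ(1) = 0`. -/
def leftHalf (φ ψ : TV ι →ₗ[ℂ] ℂ) : TV ι →ₗ[ℂ] ℂ := dualProd (halfExtend coprodLeftV) φ ψ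

/-- The right half-shuffle product `φ ≻ ψ`. The value on `1` is `0`, and the same formula gives
`ε ≻ φ = φ` and `φ ≻ ε = 0` for every form `φ` with `φ(1) = 0`. -/
def rightHalf (φ ψ : TV ι →ₗ[ℂ] ℂ) : TV ι →ₗ[ℂ] ℂ := dualProd (halfExtend coprodRightV) φ ψ

/-- The counit `ε : T(V) → ℂ`, the projection to the scalar component. -/
def counit : TV ι →ₐ[ℂ] ℂ := TensorAlgebra.algebraMapInv

/-- `ψ` is a two-sided inverse of `φ` for the convolution product. -/
def IsConvInverse (φ ψ : TV ι →ₗ[ℂ] ℂ) : Prop :=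
  conv φ ψ = counit.toLinearMap ∧ conv ψ φ = counit.toLinearMap

/-- Infinitesimal characters: linear forms that vanish on `1` and on `V^{⊗ n}` for `n ≥ 2`. -/
def IsInfinitesimalCharacter (κ : TV ι →ₗ[ℂ] ℂ) : Prop :=
  κ 1 = 0 ∧ ∀ n : ℕ, 2 ≤ n → ∀ t ∈ LinearMap.range (TensorAlgebra.ι ℂ (M := V ι)) ^ n, κ t = 0

/-- The generating series `Λ(μ) = μ(1) + ∑_w μ(w) x_w` of a linear form `μ` on `T(V)`. -/
def genSeries (μ : TV ι →ₗ[ℂ] ℂ) : NCPowerSeries ι ℂ := fun w => μ (ofWord w)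

/-- The moment character `Φ` of a family `b` of random variables in `(B, φ)`: the algebra morphism
with `Φ(i_1 ⋯ i_k) = φ(b_{i_1} ⋯ b_{i_k})` for every non-empty word `i_1 ⋯ i_k`. -/
def momentCharacter {B : Type*} [Ring B] [Algebra ℂ B] (φ : B →ₗ[ℂ] ℂ) (b : ι → B) :
    TV ι →ₐ[ℂ] ℂ :=
  TensorAlgebra.lift ℂ
    (Finsupp.linearCombination ℂ fun w : FreeSemigroup ι => φ (((w.head :: w.tail).map b).prod))

/-- `κ` is the infinitesimal character of free cumulants of `Φ`: `Φ = ε + κ ≺ Φ`. -/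
def IsFreeCumulants (Φ κ : TV ι →ₗ[ℂ] ℂ) : Prop :=
  IsInfinitesimalCharacter κ ∧ Φ = counit.toLinearMap + leftHalf κ Φ

/-- `β` is the infinitesimal character of Boolean cumulants of `Φ`: `Φ = ε + Φ ≻ β`. -/
def IsBooleanCumulants (Φ β : TV ι →ₗ[ℂ] ℂ) : Prop :=
  IsInfinitesimalCharacter β ∧ Φ = counit.toLinearMap + rightHalf Φ β

end WordHopf

end

/-! Write $g=\widehat\Phi$, let $k$ be its multiplicative inverse and let $\sigma_g(f)=f(xg(x))$.
Let $\partial_a$ (`shift a`) remove a leading letter $a$. Everything about $\sigma_g$ follows from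
$\partial_a\sigma_g(f)=g\,\sigma_g(\partial_a f)$ (`substShifted_cons`). In particular $\sigma_g$ is
a ring endomorphism, and it is bijective because $g$ is invertible.

Reading a word letter by letter turns the sums over $S$ into substitutions
(`sumMarkings_gapWeight`). On words, for a character $\psi$ and infinitesimal $\kappa,\beta$, this
gives $\widehat{\mu*\psi}=\widehat\psi\,\sigma_{\widehat\psi}(\widehat\mu)$,
$\widehat{\kappa\prec\psi}=\sigma_{\widehat\psi}(\widehat\kappa)$ and
$\widehat{\mu\succ\beta}=\widehat\beta\,\widehat\mu$, the last one on non-empty words. Characters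
and infinitesimal characters are determined by their series, and the half-products in the cumulant
equations factor on $w|t$, so no information is lost by looking at words only.

With $f=\widehat{\Phi^{-1}}$ the three defining equations become $\sigma_g(f)=k$,
$\sigma_g(1+\widehat\kappa)=g$ and $\widehat\beta=1-k$. Existence and uniqueness of the cumulants,
and existence of the inverse, follow from bijectivity of $\sigma_g$ and invertibility of $g$.
Applying $\sigma_g$ to $f(1+\widehat\kappa)$ gives $kg=1$, which is (i); (ii) is
$\widehat\beta=1-\sigma_g(f)$. Uniqueness of the inverse among all linear forms needs the
cancellation law `conv_conv_cancel`. -/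

noncomputable section

/-! ### Recursion on the first letter, and inverses of series -/

namespace NCPowerSeries

variable {ι : Type*} {A : Type*}

/-- Two series with the same constant term and the same shifts are equal. -/
theorem ext_shift {f g : NCPowerSeries ι A} (h₀ : f [] = g []) (h : ∀ a, shift a f = shift a g) :
    f = g := by
  ext w
  cases w with
  | nil => exact h₀
  | cons a w => exact congrFun (h a) w

/-- To prove an identity of series depending on parameters it suffices to compare constant terms
and to compare shifts modulo the identity in lower length. -/
theorem eq_of_shift {α : Type*} (F G : α → NCPowerSeries ι A) (h₀ : ∀ x, F x [] = G x [])
    (h : ∀ w x a, (∀ v : List ι, v.length ≤ w.length → ∀ y, F y v = G y v) →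
      F x (a :: w) = G x (a :: w)) (x : α) : F x = G x := by
  have : ∀ n : ℕ, ∀ w : List ι, w.length ≤ n → ∀ x, F x w = G x w := by
    intro n
    induction n with
    | zero =>
      intro w hw x
      rw [List.length_eq_zero_iff.1 (Nat.le_zero.1 hw)]
      exact h₀ x
    | succ n ih =>
      intro w hw x
      cases w with
      | nil => exact h₀ x
      | cons a w =>
        have hw' : w.length ≤ n := by simpa using hw
        exact h w x a fun v hv y => ih v (hv.trans hw') y
  ext w
  exact this _ w le_rfl x

variable [CommRing A]

theorem sub_apply (f g : NCPowerSeries ι A) (w : List ι) : (f - g) w = f w - g w := rfl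

theorem shift_one (a : ι) : shift a (1 : NCPowerSeries ι A) = 0 := rfl

/-- The series `c f` for a scalar `c`. -/
def scale (c : A) (f : NCPowerSeries ι A) : NCPowerSeries ι A := fun w => c * f w

/-- Removing the first letter is a derivation twisted by the constant term: the letter lies in `g`
only when the `f`-part of the cut is empty. -/
theorem shift_mul (a : ι) (f g : NCPowerSeries ι A) :
    shift a (f * g) = scale (f []) (shift a g) + shift a f * g := by
  ext w
  exact mul_cons f g a w

theorem mul_scale (c : A) (f g : NCPowerSeries ι A) : f * scale c g = scale c (f * g) := by
  ext w
  simp only [mul_apply, scale, Finset.mul_sum]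
  exact Finset.sum_congr rfl fun j _ => by ring

theorem mul_congr_right (f : NCPowerSeries ι A) {g h : NCPowerSeries ι A} {w : List ι}
    (H : ∀ v : List ι, v.length ≤ w.length → g v = h v) : (f * g) w = (f * h) w := by
  simp only [mul_apply]
  exact Finset.sum_congr rfl fun j _ => by rw [H _ (by simp)]

/-- The coefficients of `divRight g f`. -/
def divRightCoeff (g : NCPowerSeries ι A) : List ι → NCPowerSeries ι A → A
  | [], f => f []
  -- If `q * g = f`, then `q [] = f []` and `shift a f = scale (q []) (shift a g) + shift a q * g`;
  -- solve for `shift a q * g`.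
  | a :: w, f => divRightCoeff g w (shift a f - scale (f []) (shift a g))

/-- Right division of `f` by a series `g` with constant term `1`. -/
def divRight (g f : NCPowerSeries ι A) : NCPowerSeries ι A := fun w => divRightCoeff g w f

theorem divRight_nil (g f : NCPowerSeries ι A) : divRight g f [] = f [] := rfl

theorem shift_divRight (g f : NCPowerSeries ι A) (a : ι) :
    shift a (divRight g f) = divRight g (shift a f - scale (f []) (shift a g)) := rfl

theorem divRight_mul (g : NCPowerSeries ι A) (hg : g [] = 1) (f : NCPowerSeries ι A) :
    divRight g f * g = f := by
  ext w
  induction w generalizing f with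
  | nil => rw [mul_nil, divRight_nil, hg, mul_one]
  | cons a w ih =>
    rw [mul_cons, shift_divRight, ih, sub_apply, divRight_nil]
    simp [shift, scale]

/-- A series with constant term `1` is invertible. -/
theorem exists_inverse (g : NCPowerSeries ι A) (hg : g [] = 1) :
    ∃ k : NCPowerSeries ι A, k [] = 1 ∧ k * g = 1 ∧ g * k = 1 := by
  have left : ∀ g : NCPowerSeries ι A, g [] = 1 →
      ∃ k : NCPowerSeries ι A, k [] = 1 ∧ k * g = 1 := fun g hg =>
    ⟨divRight g 1, rfl, divRight_mul g hg 1⟩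
  obtain ⟨k, hk, hkg⟩ := left g hg
  -- The left inverse `k` again has constant term 1, so it has a left inverse `l`; then `l = g` and
  -- `k` is two-sided.
  obtain ⟨l, -, hlk⟩ := left k hk
  refine ⟨k, hk, hkg, ?_⟩
  rwa [← left_inv_eq_right_inv hlk hkg]

/-! ### The substitution operator and its inverse -/

/-- The series `f(xg(x))`. -/
def substShifted (g f : NCPowerSeries ι A) : NCPowerSeries ι A := subst (shiftedVars g) f

theorem prod_shiftedVars_cons_cons_of_ne (g : NCPowerSeries ι A) {a i : ι} (h : a ≠ i)
    (v w : List ι) : ((i :: v).map (shiftedVars g)).prod (a :: w) = 0 := by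
  have h0 : (shiftedVars g i) [] = 0 := by simp [shiftedVars, mul_nil, X]
  have := shift_X_mul_ne a i h g
  rw [List.map_cons, List.prod_cons, mul_cons, h0, zero_mul, zero_add, shiftedVars, this,
    NCPowerSeries.zero_mul', zero_apply]

theorem shift_X_self (a : ι) : shift a (X a : NCPowerSeries ι A) = 1 := by
  ext w
  cases w with
  | nil => simp [shift, X, one_nil]
  | cons b w => simp [shift, X, one_cons]

theorem prod_shiftedVars_cons_cons (g : NCPowerSeries ι A) (a : ι) (v w : List ι) :
    ((a :: v).map (shiftedVars g)).prod (a :: w) = (g * (v.map (shiftedVars g)).prod) w := by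
  have h0 : (X a : NCPowerSeries ι A) [] = 0 := by simp [X]
  rw [List.map_cons, List.prod_cons, shiftedVars, mul_assoc, mul_cons, h0, zero_mul, zero_add,
    shift_X_self, one_mul]

/-- The index set `s` is left free so that the coefficients at all suffixes of one word can be
summed over the same finite set. -/
theorem substShifted_eq_sum (g f : NCPowerSeries ι A) (w : List ι) (s : Finset (List ι))
    (hs : ∀ v : List ι, v.Sublist w → v ∈ s) :
    substShifted g f w = ∑ v ∈ s, f v * (v.map (shiftedVars g)).prod w := by
  refine finsum_eq_sum_of_support_subset _ fun v hv => ?_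
  exact hs v (sublist_of_shifted_ne_zero g v w (right_ne_zero_of_mul hv))

theorem substShifted_nil (g f : NCPowerSeries ι A) : substShifted g f [] = f [] := by
  rw [substShifted_eq_sum g f [] {[]} (by simp)]
  simp [one_nil]

/-- Only monomials `a :: v` of `f` contribute to a word beginning with `a`; each contributes `x_a g`
times the rest, and stripping `x_a` leaves the factor `g`. -/
theorem substShifted_cons (g f : NCPowerSeries ι A) (a : ι) (w : List ι) :
    substShifted g f (a :: w) = (g * substShifted g (shift a f)) w := by
  classical
  have hs : ∀ v : List ι, v.Sublist w → v ∈ w.sublists.toFinset := by simp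
  have h₁ : substShifted g f (a :: w) =
      ∑ᶠ v ∈ Set.range (List.cons a), f v * (v.map (shiftedVars g)).prod (a :: w) := by
    refine (finsum_mem_univ _).symm.trans (finsum_mem_inter_support_eq _ _ _ ?_)
    ext v
    simp only [Set.mem_inter_iff, Set.mem_univ, true_and, Set.mem_range, Function.mem_support,
      ne_eq, iff_and_self]
    intro h
    cases v with
    | nil => simp [one_cons] at h
    | cons i v =>
      by_cases hai : a = i
      · exact ⟨v, by rw [hai]⟩
      · rw [prod_shiftedVars_cons_cons_of_ne g hai, mul_zero] at h
        exact absurd rfl h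
  rw [h₁, finsum_mem_range (List.cons_injective)]
  simp only [prod_shiftedVars_cons_cons]
  rw [finsum_eq_sum_of_support_subset (s := w.sublists.toFinset), mul_apply]
  · simp only [mul_apply, Finset.mul_sum]
    rw [Finset.sum_comm]
    refine Finset.sum_congr rfl fun j _ => ?_
    rw [substShifted_eq_sum g _ (w.drop j) _
      fun v hv => hs v (hv.trans (List.drop_sublist j w)), Finset.mul_sum]
    exact Finset.sum_congr rfl fun v _ => by rw [shift]; ring
  · intro v hv
    have h := right_ne_zero_of_mul hv
    rw [mul_apply] at h
    obtain ⟨j, -, hj⟩ := Finset.exists_ne_zero_of_sum_ne_zero h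
    exact hs v ((sublist_of_shifted_ne_zero g v _ (right_ne_zero_of_mul hj)).trans
      (List.drop_sublist j w))

theorem shift_substShifted (g f : NCPowerSeries ι A) (a : ι) :
    shift a (substShifted g f) = g * substShifted g (shift a f) := by
  ext w
  exact substShifted_cons g f a w

theorem substShifted_add (g f h : NCPowerSeries ι A) :
    substShifted g (f + h) = substShifted g f + substShifted g h := by
  classical
  ext w
  rw [add_apply]
  simp only [substShifted_eq_sum g _ w w.sublists.toFinset (by simp), add_apply, add_mul,
    Finset.sum_add_distrib]

theorem substShifted_scale (g : NCPowerSeries ι A) (c : A) (f : NCPowerSeries ι A) :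
    substShifted g (scale c f) = scale c (substShifted g f) := by
  classical
  ext w
  simp only [scale, substShifted_eq_sum g _ w w.sublists.toFinset (by simp), Finset.mul_sum,
    mul_assoc]

theorem substShifted_zero (g : NCPowerSeries ι A) : substShifted g 0 = 0 := by
  simpa using substShifted_add g 0 0

theorem substShifted_one (g : NCPowerSeries ι A) : substShifted g 1 = 1 :=
  ext_shift (by rw [substShifted_nil]) fun a => by
    rw [shift_substShifted, shift_one, substShifted_zero, mul_zero]

/-- With `h` fixed and `f` varying, both sides satisfy the same first-letter recursion, by the
twisted Leibniz rule. -/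
theorem substShifted_mul (g f h : NCPowerSeries ι A) :
    substShifted g (f * h) = substShifted g f * substShifted g h := by
  refine eq_of_shift (fun f => substShifted g (f * h))
    (fun f => substShifted g f * substShifted g h) (fun f => ?_) (fun w f a ih => ?_) f
  · simp only [substShifted_nil, mul_nil]
  · change shift a (substShifted g (f * h)) w = shift a (substShifted g f * substShifted g h) w
    simp only [shift_substShifted, shift_mul, substShifted_add, substShifted_scale, mul_add,
      mul_scale, substShifted_nil, add_apply, mul_assoc]
    rw [mul_congr_right g fun v hv => ih v hv (shift a f)]

theorem substShifted_one_left (f : NCPowerSeries ι A) : substShifted 1 f = f := by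
  refine eq_of_shift (substShifted 1) id (fun f => substShifted_nil 1 f) (fun w f a ih => ?_) f
  rw [substShifted_cons, one_mul, ih w le_rfl]
  rfl

/-- The substitutions `x ↦ xg(x)` and `x ↦ xh(x)` are inverse to each other on one side if
`g(x) h(xg(x)) = 1`. -/
theorem substShifted_substShifted (g h : NCPowerSeries ι A) (H : g * substShifted g h = 1)
    (f : NCPowerSeries ι A) : substShifted g (substShifted h f) = f := by
  refine eq_of_shift (fun f => substShifted g (substShifted h f)) id
    (fun f => by simp [substShifted_nil]) (fun w f a ih => ?_) f
  -- A shift of the composite produces the factor `g * substShifted g h`, which `H` cancels.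
  simp only [substShifted_cons, shift_substShifted, substShifted_mul]
  rw [← mul_assoc, H, one_mul]
  exact ih w le_rfl (shift a f)

/-- The coefficients of `unsubst k f`. -/
def unsubstCoeff (k : NCPowerSeries ι A) : List ι → NCPowerSeries ι A → A
  | [], f => f []
  -- If `u` has image `f`, then `shift a f` is `g` times the image of `shift a u`; multiplying by
  -- `k` removes `g`.
  | a :: w, f => unsubstCoeff k w (k * shift a f)

/-- The inverse of the substitution `x ↦ xg(x)`, where `k` is the multiplicative inverse of `g`. -/
def unsubst (k f : NCPowerSeries ι A) : NCPowerSeries ι A := fun w => unsubstCoeff k w f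

theorem unsubst_nil (k f : NCPowerSeries ι A) : unsubst k f [] = f [] := rfl

theorem unsubst_cons (k f : NCPowerSeries ι A) (a : ι) (w : List ι) :
    unsubst k f (a :: w) = unsubst k (k * shift a f) w := rfl

theorem shift_unsubst (k f : NCPowerSeries ι A) (a : ι) :
    shift a (unsubst k f) = unsubst k (k * shift a f) := rfl

theorem substShifted_unsubst (g k : NCPowerSeries ι A) (hgk : g * k = 1)
    (f : NCPowerSeries ι A) : substShifted g (unsubst k f) = f := by
  refine eq_of_shift (fun f => substShifted g (unsubst k f)) id
    (fun f => by rw [substShifted_nil, unsubst_nil, id]) (fun w f a ih => ?_) f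
  rw [substShifted_cons, shift_unsubst, mul_congr_right g fun v hv => ih v hv (k * shift a f), id,
    ← mul_assoc, hgk, one_mul]
  rfl

theorem unsubst_substShifted (g k : NCPowerSeries ι A) (hkg : k * g = 1)
    (f : NCPowerSeries ι A) : unsubst k (substShifted g f) = f := by
  refine eq_of_shift (fun f => unsubst k (substShifted g f)) id
    (fun f => substShifted_nil g f) (fun w f a ih => ?_) f
  rw [unsubst_cons, shift_substShifted, ← mul_assoc, hkg, one_mul]
  exact ih w le_rfl (shift a f)

end NCPowerSeries

open NCPowerSeries

/-! ## Sums over the subsets of the positions of a word -/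

/-- The sum of `F m` over all markings `m` of the word `w` by Booleans. -/
def sumMarkings {α M : Type*} [AddCommMonoid M] : List α → (List (α × Bool) → M) → M
  | [], F => F []
  | a :: w, F =>
    sumMarkings w (fun m => F ((a, true) :: m)) + sumMarkings w (fun m => F ((a, false) :: m))

theorem map_sumMarkings {α M N : Type*} [AddCommMonoid M] [AddCommMonoid N] (L : M →+ N)
    (w : List α) (F : List (α × Bool) → M) :
    L (sumMarkings w F) = sumMarkings w fun m => L (F m) := by
  induction w generalizing F with
  | nil => rfl
  | cons a w ih => simp only [sumMarkings, map_add, ih]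

theorem sumMarkings_zero {α M : Type*} [AddCommMonoid M] (w : List α) :
    sumMarkings w (fun _ => (0 : M)) = 0 := by
  induction w with
  | nil => rfl
  | cons a w ih => simp only [sumMarkings, ih, add_zero]

theorem sumMarkings_mul_left {α A : Type*} [NonUnitalNonAssocSemiring A] (c : A) (w : List α)
    (F : List (α × Bool) → A) : sumMarkings w (fun m => c * F m) = c * sumMarkings w F :=
  (map_sumMarkings (AddMonoidHom.mulLeft c) w F).symm

theorem sumMarkings_mul_right {α A : Type*} [NonUnitalNonAssocSemiring A] (c : A) (w : List α)
    (F : List (α × Bool) → A) : sumMarkings w F * c = sumMarkings w fun m => F m * c :=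
  map_sumMarkings (AddMonoidHom.mulRight c) w F

theorem sum_bool_eq_sumMarkings {α M : Type*} [AddCommMonoid M] {n : ℕ} (w : Fin n → α)
    (F : List (α × Bool) → M) :
    ∑ c : Fin n → Bool, F (List.ofFn fun j => (w j, c j)) = sumMarkings (List.ofFn w) F := by
  induction n generalizing F with
  | zero => simp [sumMarkings]
  | succ n ih =>
    rw [List.ofFn_succ, sumMarkings, ← ih, ← ih,
      ← (Fin.consEquiv fun _ : Fin (n + 1) => Bool).sum_comp, Fintype.sum_prod_type,
      Fintype.sum_bool]
    simp [Fin.consEquiv, List.ofFn_succ]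

/-- The word `w` with the letters on the positions in `S` marked. -/
def marking {α : Type*} {n : ℕ} (w : Fin n → α) (S : Finset (Fin n)) : List (α × Bool) :=
  (List.finRange n).map fun j => (w j, decide (j ∈ S))

/-- This replaces subsets of positions by a recursion on the first letter, the form in which series
are compared. -/
theorem sum_finset_eq_sumMarkings {α M : Type*} [AddCommMonoid M] {n : ℕ} (w : Fin n → α)
    (F : List (α × Bool) → M) :
    ∑ S : Finset (Fin n), F (marking w S) = sumMarkings (List.ofFn w) F := by
  rw [← sum_bool_eq_sumMarkings]
  refine Fintype.sum_equiv
    ⟨fun S j => decide (j ∈ S), fun c => Finset.univ.filter fun j => c j = true,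
      fun S => by ext; simp, fun c => by ext; simp⟩ _ _ fun S => ?_
  simp [marking, List.ofFn_eq_map]

theorem splitOnP_map {α β : Type*} (f : α → β) (p : β → Bool) (l : List α) :
    (l.map f).splitOnP p = (l.splitOnP (p ∘ f)).map (List.map f) := by
  induction l with
  | nil => simp
  | cons a l ih =>
    rw [List.map_cons, List.splitOnP_cons_eq_if_modifyHead, List.splitOnP_cons_eq_if_modifyHead,
      ih]
    by_cases h : p (f a)
    · simp [h]
    · obtain ⟨x, y, hx⟩ := List.exists_cons_of_ne_nil (List.splitOnP_ne_nil (p ∘ f) l)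
      simp [h, hx]

/-- The subword of marked letters. -/
def selected {α : Type*} (m : List (α × Bool)) : List α := (m.filter Prod.snd).map Prod.fst

/-- The words between consecutive marked letters, empty words included. -/
def gapWords {α : Type*} (m : List (α × Bool)) : List (List α) :=
  (m.splitOnP Prod.snd).map (List.map Prod.fst)

theorem selected_cons_true {α : Type*} (a : α) (m : List (α × Bool)) :
    selected ((a, true) :: m) = a :: selected m := by simp [selected]

theorem selected_cons_false {α : Type*} (a : α) (m : List (α × Bool)) :
    selected ((a, false) :: m) = selected m := by simp [selected]

theorem gapWords_nil {α : Type*} : gapWords ([] : List (α × Bool)) = [[]] := by simp [gapWords]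

theorem gapWords_cons_true {α : Type*} (a : α) (m : List (α × Bool)) :
    gapWords ((a, true) :: m) = [] :: gapWords m := by
  simp [gapWords, List.splitOnP_cons_eq_if_modifyHead]

theorem gapWords_ne_nil {α : Type*} (m : List (α × Bool)) : gapWords m ≠ [] := by
  simp [gapWords]

theorem gapWords_cons_false {α : Type*} (a : α) (m : List (α × Bool)) :
    gapWords ((a, false) :: m) = (gapWords m).modifyHead (List.cons a) := by
  obtain ⟨x, y, hx⟩ := List.exists_cons_of_ne_nil (List.splitOnP_ne_nil Prod.snd m)
  simp [gapWords, List.splitOnP_cons_eq_if_modifyHead, hx]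

/-- The product of `h` at the first gap word and of `g` at the other ones. -/
def gapWeight {ι A : Type*} [CommRing A] (g h : NCPowerSeries ι A) (L : List (List ι)) : A :=
  h L.headI * (L.tail.map fun J => g J).prod

/-- Summing over all subwords, with the gaps weighted by `g`, is the substitution
`x ↦ xg(x)`. -/
theorem sumMarkings_gapWeight {ι A : Type*} [CommRing A] (g h f : NCPowerSeries ι A)
    (w : List ι) :
    sumMarkings w (fun m => f (selected m) * gapWeight g h (gapWords m)) =
      (h * substShifted g f) w := by
  induction w generalizing h f with
  | nil =>
    simp [sumMarkings, selected, gapWords_nil, gapWeight, mul_nil, substShifted_nil, mul_comm,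
      List.headI]
  | cons a w ih =>
    -- A marked first letter closes the first gap as empty, with weight `h []`, and the next gap
    -- gets the ordinary weight `g`.
    have h₁ : ∀ m : List (ι × Bool), f (selected ((a, true) :: m)) *
        gapWeight g h (gapWords ((a, true) :: m)) =
          h [] * (shift a f (selected m) * gapWeight g g (gapWords m)) := fun m => by
      obtain ⟨x, y, hx⟩ := List.exists_cons_of_ne_nil (gapWords_ne_nil m)
      rw [selected_cons_true, gapWords_cons_true, hx]
      simp only [gapWeight, List.headI, List.tail, List.map_cons, List.prod_cons, shift]
      ring
    -- An unmarked first letter joins the first gap, which turns its weight `h` into `shift a h`.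
    -- This is why the first gap has a weight of its own.
    have h₂ : ∀ m : List (ι × Bool), f (selected ((a, false) :: m)) *
        gapWeight g h (gapWords ((a, false) :: m)) =
          f (selected m) * gapWeight g (shift a h) (gapWords m) := fun m => by
      obtain ⟨x, y, hx⟩ := List.exists_cons_of_ne_nil (gapWords_ne_nil m)
      rw [selected_cons_false, gapWords_cons_false, hx]
      simp [gapWeight, shift]
    simp only [sumMarkings, h₁, h₂]
    rw [sumMarkings_mul_left, ih, ih, mul_cons, substShifted_cons]

/-! ### The coproducts as sums over markings -/

namespace WordHopf

variable {ι : Type*}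

/-- The term of the coproduct that belongs to a marked word. -/
def markTerm (m : List (ι × Bool)) : TV ι ⊗[ℂ] TV ι :=
  ofWord (selected m) ⊗ₜ[ℂ] ((gapWords m).map ofWord).prod

/-- Empty gaps contribute the unit of `T(V)`, so keeping them does not change the product. -/
theorem prod_map_ofWord_filter {α : Type*} (f : α → ι) (L : List (List α)) :
    ((L.filter fun J => !J.isEmpty).map fun J => ofWord (J.map f)).prod =
      (L.map fun J => ofWord (J.map f)).prod := by
  induction L with
  | nil => rfl
  | cons J L ih =>
    cases J with
    | nil => simpa [ofWord] using ih
    | cons a J => simpa using congrArg (ofWord (f a :: J.map f) * ·) ih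

theorem coprodTerm_eq_markTerm (w : FreeSemigroup ι) (S : Finset (Fin (len w))) :
    coprodTerm w S = markTerm (marking (letter w) S) := by
  rw [coprodTerm, markTerm, gaps, prod_map_ofWord_filter]
  congr 2
  · simp [selected, marking, List.filter_map, Function.comp_def]
  · simp [gapWords, marking, splitOnP_map, Function.comp_def]

theorem ofFn_letter (w : FreeSemigroup ι) : List.ofFn (letter w) = w.head :: w.tail :=
  List.ofFn_get (w.head :: w.tail)

theorem sum_coprodTerm (a : ι) (l : List ι) :
    ∑ S, coprodTerm ⟨a, l⟩ S = sumMarkings (a :: l) markTerm := by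
  simp only [coprodTerm_eq_markTerm]
  rw [sum_finset_eq_sumMarkings, ofFn_letter]

theorem head_marking (w : FreeSemigroup ι) (S : Finset (Fin (len w))) :
    ((marking (letter w) S).head?.any Prod.snd) = decide (0 ∈ S) := by
  simp [marking, len, List.finRange_succ]

theorem sum_coprodTerm_left (a : ι) (l : List ι) :
    ∑ S with 0 ∈ S, coprodTerm ⟨a, l⟩ S = sumMarkings l fun m => markTerm ((a, true) :: m) := by
  rw [Finset.sum_filter]
  have h : ∀ S : Finset (Fin (len (⟨a, l⟩ : FreeSemigroup ι))),
      (if 0 ∈ S then coprodTerm ⟨a, l⟩ S else 0) =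
        (fun m : List (ι × Bool) => if m.head?.any Prod.snd then markTerm m else 0)
          (marking (letter ⟨a, l⟩) S) := fun S => by
    simp only [head_marking, coprodTerm_eq_markTerm, decide_eq_true_eq]
  refine (Finset.sum_congr rfl fun S _ => h S).trans
    ((sum_finset_eq_sumMarkings _
      fun m : List (ι × Bool) => if m.head?.any Prod.snd then markTerm m else 0).trans ?_)
  rw [ofFn_letter]
  simp [sumMarkings, sumMarkings_zero]

theorem sum_coprodTerm_right (a : ι) (l : List ι) :
    ∑ S with 0 ∉ S, coprodTerm ⟨a, l⟩ S = sumMarkings l fun m => markTerm ((a, false) :: m) := by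
  rw [Finset.sum_filter]
  have h : ∀ S : Finset (Fin (len (⟨a, l⟩ : FreeSemigroup ι))),
      (if 0 ∉ S then coprodTerm ⟨a, l⟩ S else 0) =
        (fun m : List (ι × Bool) => if m.head?.any Prod.snd then 0 else markTerm m)
          (marking (letter ⟨a, l⟩) S) := fun S => by
    simp only [head_marking, coprodTerm_eq_markTerm, decide_eq_true_eq, ite_not]
  refine (Finset.sum_congr rfl fun S _ => h S).trans
    ((sum_finset_eq_sumMarkings _
      fun m : List (ι × Bool) => if m.head?.any Prod.snd then 0 else markTerm m).trans ?_)
  rw [ofFn_letter]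
  simp [sumMarkings, sumMarkings_zero]

theorem coprod_ofWord_cons (a : ι) (l : List ι) :
    coprod (ofWord (a :: l)) = sumMarkings (a :: l) markTerm := by
  simp [coprod, ofWord, coprodV, sum_coprodTerm]

theorem coprodLeftV_single (a : ι) (l : List ι) :
    coprodLeftV (Finsupp.single ⟨a, l⟩ 1) = sumMarkings l fun m => markTerm ((a, true) :: m) := by
  simp [coprodLeftV, sum_coprodTerm_left]

theorem coprodRightV_single (a : ι) (l : List ι) :
    coprodRightV (Finsupp.single ⟨a, l⟩ 1) =
      sumMarkings l fun m => markTerm ((a, false) :: m) := by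
  simp [coprodRightV, sum_coprodTerm_right]

/-! ## Linear forms on `T(V)` -/

/-- Linear maps on `V` are determined by their values on words. -/
theorem V_hom_ext {M : Type*} [AddCommMonoid M] [Module ℂ M] {F G : V ι →ₗ[ℂ] M}
    (h : ∀ a l, F (Finsupp.single ⟨a, l⟩ 1) = G (Finsupp.single ⟨a, l⟩ 1)) : F = G :=
  Finsupp.lhom_ext' fun w => LinearMap.ext_ring (h w.head w.tail)

/-- Linear maps on `T(V)` are determined by their values on `1` and on the products `w | t`. -/
theorem linearMap_ext {M : Type*} [AddCommMonoid M] [Module ℂ M] {F G : TV ι →ₗ[ℂ] M}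
    (h₁ : F 1 = G 1) (h : ∀ a l t, F (ofWord (a :: l) * t) = G (ofWord (a :: l) * t)) :
    F = G := by
  have hv : ∀ (v : V ι) (t : TV ι),
      F (TensorAlgebra.ι ℂ v * t) = G (TensorAlgebra.ι ℂ v * t) := fun v t =>
    LinearMap.congr_fun (V_hom_ext (F := F ∘ₗ LinearMap.mulRight ℂ t ∘ₗ TensorAlgebra.ι ℂ)
      (G := G ∘ₗ LinearMap.mulRight ℂ t ∘ₗ TensorAlgebra.ι ℂ) fun a l => h a l t) v
  -- The right factor `s` makes the induction pass through products: `a * b` is handled by applying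
  -- `ha` to `b * s`.
  have key : ∀ t s : TV ι, F s = G s → F (t * s) = G (t * s) := by
    intro t
    induction t using TensorAlgebra.induction with
    | algebraMap r =>
      intro s hs
      rw [← Algebra.smul_def, map_smul, map_smul, hs]
    | ι v => exact fun s _ => hv v s
    | mul a b ha hb =>
      intro s hs
      rw [mul_assoc]
      exact ha _ (hb s hs)
    | add a b ha hb =>
      intro s hs
      rw [add_mul, map_add, map_add, ha s hs, hb s hs]
  ext t
  simpa using key t 1 h₁

theorem algHom_ext {A : Type*} [Semiring A] [Algebra ℂ A] {F G : TV ι →ₐ[ℂ] A}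
    (h : ∀ w, F (ofWord w) = G (ofWord w)) : F = G :=
  TensorAlgebra.hom_ext (V_hom_ext fun a l => h (a :: l))

/-- The character with a given generating series. -/
def ofSeries (f : NCPowerSeries ι ℂ) : TV ι →ₐ[ℂ] ℂ :=
  TensorAlgebra.lift ℂ
    (Finsupp.linearCombination ℂ fun w : FreeSemigroup ι => f (w.head :: w.tail))

theorem genSeries_ofSeries {f : NCPowerSeries ι ℂ} (hf : f [] = 1) :
    genSeries (ofSeries f).toLinearMap = f := by
  ext w
  cases w with
  | nil => simp [genSeries, ofWord, hf]
  | cons a l => simp [genSeries, ofWord, ofSeries]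

theorem genSeries_nil (μ : TV ι →ₗ[ℂ] ℂ) : genSeries μ [] = μ 1 := rfl

theorem genSeries_character_nil (ψ : TV ι →ₐ[ℂ] ℂ) : genSeries ψ.toLinearMap [] = 1 :=
  map_one ψ

theorem counit_ofWord_cons (a : ι) (l : List ι) : counit (ofWord (a :: l)) = 0 := by
  simp [counit, ofWord, TensorAlgebra.algebraMapInv]

theorem genSeries_counit : genSeries (counit (ι := ι)).toLinearMap = 1 := by
  ext w
  cases w with
  | nil => exact map_one counit
  | cons a l => exact counit_ofWord_cons a l

/-! ## Infinitesimal characters -/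

/-- The character `ε + f ϵ` of `T(V)` with values in the dual numbers. -/
def dualCharacter (f : NCPowerSeries ι ℂ) : TV ι →ₐ[ℂ] TrivSqZeroExt ℂ ℂ :=
  TensorAlgebra.lift ℂ (TrivSqZeroExt.inrHom ℂ ℂ ∘ₗ
    Finsupp.linearCombination ℂ fun w : FreeSemigroup ι => f (w.head :: w.tail))

/-- The infinitesimal character with a given generating series. -/
def infinitesimal (f : NCPowerSeries ι ℂ) : TV ι →ₗ[ℂ] ℂ :=
  TrivSqZeroExt.sndHom ℂ ℂ ∘ₗ (dualCharacter f).toLinearMap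

theorem genSeries_infinitesimal {f : NCPowerSeries ι ℂ} (hf : f [] = 0) :
    genSeries (infinitesimal f) = f := by
  ext w
  cases w with
  | nil => simp [genSeries, ofWord, infinitesimal, hf]
  | cons a l => simp [genSeries, ofWord, infinitesimal, dualCharacter]

theorem fst_dualCharacter (f : NCPowerSeries ι ℂ) (t : TV ι) :
    (dualCharacter f t).fst = counit t := by
  have h : (TrivSqZeroExt.fstHom ℂ ℂ ℂ).comp (dualCharacter f) = counit :=
    TensorAlgebra.hom_ext <| by
      ext w
      simp [dualCharacter, counit, TensorAlgebra.algebraMapInv]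
  exact DFunLike.congr_fun h t

/-- The coefficient of `ϵ` in a product of dual numbers, where `ϵ² = 0`: the form is a derivation
along the counit. -/
theorem infinitesimal_mul (f : NCPowerSeries ι ℂ) (x y : TV ι) : infinitesimal f (x * y) =
    counit x * infinitesimal f y + counit y * infinitesimal f x := by
  simp [infinitesimal, fst_dualCharacter, mul_comm]

theorem isInfinitesimalCharacter_infinitesimal (f : NCPowerSeries ι ℂ) :
    IsInfinitesimalCharacter (infinitesimal f) := by
  refine ⟨by simp [infinitesimal], fun n hn t ht => ?_⟩
  have hc : ∀ v : V ι, counit (TensorAlgebra.ι ℂ v) = 0 := fun v => by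
    simp [counit, TensorAlgebra.algebraMapInv]
  -- The counit kills positive degree, so the derivation rule kills products of two factors of
  -- positive degree.
  have hm : ∀ k, ∀ s ∈ LinearMap.range (TensorAlgebra.ι ℂ (M := V ι)) ^ (k + 1),
      counit s = 0 := by
    intro k s hs
    rw [pow_succ'] at hs
    induction hs using Submodule.mul_induction_on' with
    | mem_mul_mem m hm n hn =>
      obtain ⟨v, rfl⟩ := hm
      rw [map_mul, hc, zero_mul]
    | add x hx y hy h₁ h₂ => rw [map_add, h₁, h₂, add_zero]
  obtain ⟨k, rfl⟩ := Nat.exists_eq_add_of_le' hn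
  rw [show k + 2 = k + 1 + 1 from rfl, pow_succ'] at ht
  induction ht using Submodule.mul_induction_on' with
  | mem_mul_mem m hm' n hn' =>
    obtain ⟨v, rfl⟩ := hm'
    rw [infinitesimal_mul, hc, hm k n hn', zero_mul, zero_mul, add_zero]
  | add x hx y hy h₁ h₂ => rw [map_add, h₁, h₂, add_zero]

namespace IsInfinitesimalCharacter

variable {κ : TV ι →ₗ[ℂ] ℂ}

/-- If `t` begins with a word, every homogeneous part of the product has tensor degree at least 2;
hence only the scalar part of `t` survives. -/
theorem apply_ofWord_cons_mul (hκ : IsInfinitesimalCharacter κ) (a : ι) (l : List ι) (t : TV ι) :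
    κ (ofWord (a :: l) * t) = κ (ofWord (a :: l)) * counit t := by
  have hmem : ∀ (a : ι) (l : List ι),
      ofWord (a :: l) ∈ LinearMap.range (TensorAlgebra.ι ℂ (M := V ι)) :=
    fun a l => ⟨_, rfl⟩
  refine LinearMap.congr_fun (linearMap_ext (F := κ ∘ₗ LinearMap.mulLeft ℂ (ofWord (a :: l)))
    (G := κ (ofWord (a :: l)) • counit.toLinearMap) ?_ fun b m t => ?_) t
  · simp
  · have h : ∀ t : TV ι, κ (ofWord (a :: l) * (ofWord (b :: m) * t)) = 0 := fun t => by
      induction t using DirectSum.Decomposition.inductionOn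
        (LinearMap.range (TensorAlgebra.ι ℂ (M := V ι)) ^ · : ℕ → Submodule ℂ (TV ι)) with
      | zero => simp
      | @homogeneous i t =>
        refine hκ.2 (i + 1 + 1) (by omega) _ ?_
        rw [pow_succ', pow_succ']
        exact Submodule.mul_mem_mul (hmem a l) (Submodule.mul_mem_mul (hmem b m) t.2)
      | add x y hx hy => rw [mul_add, mul_add, map_add, hx, hy, add_zero]
    simp [h t, counit_ofWord_cons]

theorem ext_genSeries {μ : TV ι →ₗ[ℂ] ℂ} (hκ : IsInfinitesimalCharacter κ)
    (hμ : IsInfinitesimalCharacter μ) (h : genSeries κ = genSeries μ) : κ = μ :=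
  linearMap_ext (hκ.1.trans hμ.1.symm) fun a l t => by
    rw [hκ.apply_ofWord_cons_mul, hμ.apply_ofWord_cons_mul]
    exact congrArg (· * counit t) (congrFun h (a :: l))

end IsInfinitesimalCharacter

/-! ## Products of forms -/

/-- The form `m ∘ (φ ⊗ ψ)` on `T(V) ⊗ T(V)`. -/
def pairing (φ ψ : TV ι →ₗ[ℂ] ℂ) : TV ι ⊗[ℂ] TV ι →ₗ[ℂ] ℂ :=
  LinearMap.mul' ℂ ℂ ∘ₗ TensorProduct.map φ ψ

theorem pairing_tmul (φ ψ : TV ι →ₗ[ℂ] ℂ) (x y : TV ι) :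
    pairing φ ψ (x ⊗ₜ y) = φ x * ψ y := by
  simp [pairing]

theorem dualProd_apply (D : TV ι →ₗ[ℂ] TV ι ⊗[ℂ] TV ι) (φ ψ : TV ι →ₗ[ℂ] ℂ) (t : TV ι) :
    dualProd D φ ψ t = pairing φ ψ (D t) := rfl

theorem pairing_markTerm (φ ψ : TV ι →ₗ[ℂ] ℂ) (m : List (ι × Bool)) :
    pairing φ ψ (markTerm m) = genSeries φ (selected m) * ψ ((gapWords m).map ofWord).prod := by
  rw [markTerm, pairing_tmul, genSeries]

theorem character_gapWords (ψ : TV ι →ₐ[ℂ] ℂ) (m : List (ι × Bool)) :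
    ψ.toLinearMap ((gapWords m).map ofWord).prod =
      gapWeight (genSeries ψ.toLinearMap) (genSeries ψ.toLinearMap) (gapWords m) := by
  obtain ⟨x, y, hx⟩ := List.exists_cons_of_ne_nil (gapWords_ne_nil m)
  simp [hx, gapWeight, genSeries, map_list_prod, Function.comp_def, List.headI]

theorem pairing_sumMarkings (φ ψ : TV ι →ₗ[ℂ] ℂ) (l : List ι)
    (F : List (ι × Bool) → TV ι ⊗[ℂ] TV ι) :
    pairing φ ψ (sumMarkings l F) = sumMarkings l fun m => pairing φ ψ (F m) :=
  map_sumMarkings (pairing φ ψ).toAddMonoidHom l F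

/-- A character `ψ` is multiplicative on the gaps, so every gap, the first included, has weight
`genSeries ψ`; `μ` may be any form. -/
theorem genSeries_conv (μ : TV ι →ₗ[ℂ] ℂ) (ψ : TV ι →ₐ[ℂ] ℂ) :
    genSeries (conv μ ψ.toLinearMap) =
      genSeries ψ.toLinearMap * substShifted (genSeries ψ.toLinearMap) (genSeries μ) := by
  ext w
  rw [genSeries, conv, dualProd_apply]
  cases w with
  | nil =>
    rw [mul_nil, substShifted_nil]
    simp [ofWord, Algebra.TensorProduct.one_def, pairing_tmul, genSeries]
  | cons a l =>
    rw [AlgHom.toLinearMap_apply, coprod_ofWord_cons, pairing_sumMarkings]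
    simp only [pairing_markTerm, character_gapWords]
    exact sumMarkings_gapWeight _ _ _ _

theorem leftHalf_one (μ ψ : TV ι →ₗ[ℂ] ℂ) : leftHalf μ ψ 1 = 0 := by
  rw [leftHalf, dualProd_apply, halfExtend_one, map_zero]

theorem rightHalf_one (μ ψ : TV ι →ₗ[ℂ] ℂ) : rightHalf μ ψ 1 = 0 := by
  rw [rightHalf, dualProd_apply, halfExtend_one, map_zero]

theorem halfExtend_ofWord_cons_mul (δ : V ι →ₗ[ℂ] TV ι ⊗[ℂ] TV ι) (a : ι) (l : List ι)
    (t : TV ι) : halfExtend δ (ofWord (a :: l) * t) =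
      δ (Finsupp.single ⟨a, l⟩ 1) * coprod t := halfExtend_mul δ _ t

theorem halfExtend_ofWord_cons (δ : V ι →ₗ[ℂ] TV ι ⊗[ℂ] TV ι) (a : ι) (l : List ι) :
    halfExtend δ (ofWord (a :: l)) = δ (Finsupp.single ⟨a, l⟩ 1) := by
  simpa using halfExtend_ofWord_cons_mul δ a l 1

/-- The first letter is marked, so the gap before it is empty and contributes 1. -/
theorem leftHalf_ofWord_cons (μ : TV ι →ₗ[ℂ] ℂ) (ψ : TV ι →ₐ[ℂ] ℂ) (a : ι) (l : List ι) :
    leftHalf μ ψ.toLinearMap (ofWord (a :: l)) =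
      substShifted (genSeries ψ.toLinearMap) (genSeries μ) (a :: l) := by
  rw [leftHalf, dualProd_apply, halfExtend_ofWord_cons, coprodLeftV_single, pairing_sumMarkings,
    substShifted_cons, ← sumMarkings_gapWeight]
  congr 1
  ext m
  rw [pairing_markTerm, selected_cons_true, gapWords_cons_true, List.map_cons, List.prod_cons,
    ofWord, one_mul, character_gapWords]
  rfl

/-- The first letter lies in a gap, and an infinitesimal `β` kills every term with a second
non-empty gap. So `β` reads a non-empty prefix and `μ` the remaining suffix. -/
theorem rightHalf_ofWord_cons (μ : TV ι →ₗ[ℂ] ℂ) {β : TV ι →ₗ[ℂ] ℂ}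
    (hβ : IsInfinitesimalCharacter β) (a : ι) (l : List ι) :
    rightHalf μ β (ofWord (a :: l)) = (genSeries β * genSeries μ) (a :: l) := by
  rw [rightHalf, dualProd_apply, halfExtend_ofWord_cons, coprodRightV_single, pairing_sumMarkings,
    mul_cons, genSeries_nil, hβ.1, zero_mul, zero_add]
  -- The later gaps have the weight of the counit, the series 1; substituting with it is the
  -- identity.
  rw [show shift a (genSeries β) * genSeries μ =
    shift a (genSeries β) * substShifted 1 (genSeries μ) by rw [substShifted_one_left],
    ← sumMarkings_gapWeight]
  congr 1
  ext m
  obtain ⟨x, y, hx⟩ := List.exists_cons_of_ne_nil (gapWords_ne_nil m)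
  rw [pairing_markTerm, selected_cons_false, gapWords_cons_false, hx, List.modifyHead_cons,
    List.map_cons, List.prod_cons, hβ.apply_ofWord_cons_mul, map_list_prod, List.map_map,
    ← genSeries_counit]
  rfl

/-- Since `coprod` is multiplicative and `ℂ` is commutative, the convolution of characters is a
character. -/
theorem conv_character (χ ψ : TV ι →ₐ[ℂ] ℂ) :
    conv χ.toLinearMap ψ.toLinearMap =
      ((Algebra.TensorProduct.lift χ ψ fun _ _ => Commute.all _ _).comp coprod).toLinearMap := by
  have h : pairing χ.toLinearMap ψ.toLinearMap =
      (Algebra.TensorProduct.lift χ ψ fun _ _ => Commute.all _ _).toLinearMap := by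
    ext x y
    simp [pairing]
  ext t
  rw [conv, dualProd_apply, h]
  rfl

/-- A convolution product of characters is determined by its generating series. -/
theorem conv_character_eq_iff (χ ψ ρ : TV ι →ₐ[ℂ] ℂ) :
    conv χ.toLinearMap ψ.toLinearMap = ρ.toLinearMap ↔
      genSeries ψ.toLinearMap *
        substShifted (genSeries ψ.toLinearMap) (genSeries χ.toLinearMap) =
          genSeries ρ.toLinearMap := by
  rw [← genSeries_conv]
  refine ⟨fun h => by rw [h], fun h => ?_⟩
  rw [conv_character] at h ⊢
  exact congrArg _ (algHom_ext fun w => congrFun h w)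

theorem counit_conv (ψ : TV ι →ₐ[ℂ] ℂ) :
    conv counit.toLinearMap ψ.toLinearMap = ψ.toLinearMap := by
  rw [conv_character_eq_iff, genSeries_counit, substShifted_one, mul_one]

theorem conv_counit (ψ : TV ι →ₐ[ℂ] ℂ) :
    conv ψ.toLinearMap counit.toLinearMap = ψ.toLinearMap := by
  rw [conv_character_eq_iff, genSeries_counit, substShifted_one_left, one_mul]

/-- On products `w | t` the left half-product with an infinitesimal character factors. -/
theorem leftHalf_ofWord_cons_mul {κ : TV ι →ₗ[ℂ] ℂ} (hκ : IsInfinitesimalCharacter κ)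
    (ψ : TV ι →ₐ[ℂ] ℂ) (a : ι) (l : List ι) (t : TV ι) :
    leftHalf κ ψ.toLinearMap (ofWord (a :: l) * t) =
      leftHalf κ ψ.toLinearMap (ofWord (a :: l)) * ψ t := by
  -- The left tensor factor already begins with a letter, so on the left factor of `D` the form `κ`
  -- acts as the counit.
  have hmul : ∀ D : TV ι ⊗[ℂ] TV ι, ∀ m : List (ι × Bool),
      pairing κ ψ.toLinearMap (markTerm ((a, true) :: m) * D) =
        pairing κ ψ.toLinearMap (markTerm ((a, true) :: m)) *
          pairing counit.toLinearMap ψ.toLinearMap D := fun D m => by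
    induction D using TensorProduct.induction_on with
    | zero => simp
    | tmul x y =>
      rw [markTerm, Algebra.TensorProduct.tmul_mul_tmul, pairing_tmul, pairing_tmul, pairing_tmul,
        selected_cons_true, hκ.apply_ofWord_cons_mul]
      simp only [AlgHom.toLinearMap_apply, map_mul]
      ring
    | add x y hx hy => rw [mul_add, map_add, hx, hy, map_add, mul_add]
  have ht : pairing counit.toLinearMap ψ.toLinearMap (coprod t) = ψ t :=
    LinearMap.congr_fun (counit_conv ψ) t
  rw [leftHalf, dualProd_apply, dualProd_apply, halfExtend_ofWord_cons,
    halfExtend_ofWord_cons_mul, coprodLeftV_single, ← ht]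
  simp only [sumMarkings_mul_right, pairing_sumMarkings, hmul]

/-- On products `w | t` the right half-product with an infinitesimal character factors. -/
theorem rightHalf_ofWord_cons_mul {β : TV ι →ₗ[ℂ] ℂ} (hβ : IsInfinitesimalCharacter β)
    (ψ : TV ι →ₐ[ℂ] ℂ) (a : ι) (l : List ι) (t : TV ι) :
    rightHalf ψ.toLinearMap β (ofWord (a :: l) * t) =
      rightHalf ψ.toLinearMap β (ofWord (a :: l)) * ψ t := by
  -- Here the right tensor factor begins with a non-empty gap, so `β` acts as the counit on the
  -- right factor of `D`.
  have hmul : ∀ D : TV ι ⊗[ℂ] TV ι, ∀ m : List (ι × Bool),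
      pairing ψ.toLinearMap β (markTerm ((a, false) :: m) * D) =
        pairing ψ.toLinearMap β (markTerm ((a, false) :: m)) *
          pairing ψ.toLinearMap counit.toLinearMap D := fun D m => by
    induction D using TensorProduct.induction_on with
    | zero => simp
    | tmul x y =>
      obtain ⟨u, v, hx⟩ := List.exists_cons_of_ne_nil (gapWords_ne_nil m)
      rw [markTerm, Algebra.TensorProduct.tmul_mul_tmul, pairing_tmul, pairing_tmul, pairing_tmul,
        gapWords_cons_false, hx, List.modifyHead_cons, List.map_cons, List.prod_cons, mul_assoc,
        hβ.apply_ofWord_cons_mul, hβ.apply_ofWord_cons_mul]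
      simp only [AlgHom.toLinearMap_apply, map_mul]
      ring
    | add x y hx hy => rw [mul_add, map_add, hx, hy, map_add, mul_add]
  have ht : pairing ψ.toLinearMap counit.toLinearMap (coprod t) = ψ t :=
    LinearMap.congr_fun (conv_counit ψ) t
  rw [rightHalf, dualProd_apply, dualProd_apply, halfExtend_ofWord_cons,
    halfExtend_ofWord_cons_mul, coprodRightV_single, ← ht]
  simp only [sumMarkings_mul_right, pairing_sumMarkings, hmul]

/-! ## Inverses and cumulants -/

/-- The summand 1 stands for the counit, since substitution fixes it. The equation on words suffices
because on `w | t` both sides acquire the factor `ψ t`. -/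
theorem isFreeCumulants_iff {κ : TV ι →ₗ[ℂ] ℂ} (hκ : IsInfinitesimalCharacter κ)
    (ψ : TV ι →ₐ[ℂ] ℂ) : IsFreeCumulants ψ.toLinearMap κ ↔
      genSeries ψ.toLinearMap = substShifted (genSeries ψ.toLinearMap) (1 + genSeries κ) := by
  have key : ∀ a l, leftHalf κ ψ.toLinearMap (ofWord (a :: l)) =
      substShifted (genSeries ψ.toLinearMap) (1 + genSeries κ) (a :: l) := fun a l => by
    rw [leftHalf_ofWord_cons, substShifted_add, substShifted_one, NCPowerSeries.add_apply, one_cons, zero_add]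
  refine ⟨fun h => ?_, fun h => ⟨hκ, linearMap_ext ?_ fun a l t => ?_⟩⟩
  · ext w
    cases w with
    | nil => simp [substShifted_nil, NCPowerSeries.add_apply, one_nil, genSeries_nil, hκ.1]
    | cons a l =>
      rw [← key, genSeries, h.2, LinearMap.add_apply, AlgHom.toLinearMap_apply,
        counit_ofWord_cons, zero_add, ← h.2]
  · simp [leftHalf_one]
  · have h' : ψ (ofWord (a :: l)) = leftHalf κ ψ.toLinearMap (ofWord (a :: l)) :=
      (congrFun h (a :: l)).trans (key a l).symm
    simp [leftHalf_ofWord_cons_mul hκ, counit_ofWord_cons, h']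

theorem isBooleanCumulants_iff {β : TV ι →ₗ[ℂ] ℂ} (hβ : IsInfinitesimalCharacter β)
    (ψ : TV ι →ₐ[ℂ] ℂ) : IsBooleanCumulants ψ.toLinearMap β ↔
      genSeries ψ.toLinearMap = 1 + genSeries β * genSeries ψ.toLinearMap := by
  refine ⟨fun h => ?_, fun h => ⟨hβ, linearMap_ext ?_ fun a l t => ?_⟩⟩
  · ext w
    cases w with
    | nil => simp [NCPowerSeries.add_apply, one_nil, mul_nil, genSeries_nil, hβ.1]
    | cons a l =>
      rw [NCPowerSeries.add_apply, one_cons, zero_add, ← rightHalf_ofWord_cons _ hβ, genSeries, h.2,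
        LinearMap.add_apply, AlgHom.toLinearMap_apply, counit_ofWord_cons, zero_add, ← h.2]
  · simp [rightHalf_one]
  · have h' : ψ (ofWord (a :: l)) = rightHalf ψ.toLinearMap β (ofWord (a :: l)) := by
      rw [rightHalf_ofWord_cons _ hβ]
      refine (congrFun h (a :: l)).trans ?_
      rw [NCPowerSeries.add_apply, one_cons, zero_add]
    simp [rightHalf_ofWord_cons_mul hβ, counit_ofWord_cons, h']

/-- The algebra morphism `(id ⊗ ψ) ∘ Δ` of `T(V)`. -/
def rightTranslate (ψ : TV ι →ₐ[ℂ] ℂ) : TV ι →ₐ[ℂ] TV ι :=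
  (Algebra.TensorProduct.lift (AlgHom.id ℂ (TV ι)) ((Algebra.ofId ℂ (TV ι)).comp ψ)
    fun x y => (Algebra.commutes (ψ y) x).symm).comp coprod

theorem conv_eq_comp_rightTranslate (μ : TV ι →ₗ[ℂ] ℂ) (ψ : TV ι →ₐ[ℂ] ℂ) :
    conv μ ψ.toLinearMap = μ ∘ₗ (rightTranslate ψ).toLinearMap := by
  have h : pairing μ ψ.toLinearMap = μ ∘ₗ
      (Algebra.TensorProduct.lift (AlgHom.id ℂ (TV ι)) ((Algebra.ofId ℂ (TV ι)).comp ψ)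
        fun x y => (Algebra.commutes (ψ y) x).symm).toLinearMap := by
    refine TensorProduct.ext' fun x y => ?_
    rw [pairing_tmul]
    rw [LinearMap.comp_apply, AlgHom.toLinearMap_apply, AlgHom.toLinearMap_apply]
    erw [Algebra.TensorProduct.lift_tmul]
    rw [AlgHom.comp_apply, Algebra.ofId_apply,
      ← Algebra.commutes, ← Algebra.smul_def, map_smul, smul_eq_mul, mul_comm]
    rfl
  ext t
  rw [conv, dualProd_apply, h]
  rfl

/-- If `φ * ψ = ε` for characters `φ` and `ψ`, then `(μ * φ) * ψ = μ` for every form `μ`. -/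
theorem conv_conv_cancel {φ ψ : TV ι →ₐ[ℂ] ℂ}
    (h : conv φ.toLinearMap ψ.toLinearMap = counit.toLinearMap) (μ : TV ι →ₗ[ℂ] ℂ) :
    conv (conv μ φ.toLinearMap) ψ.toLinearMap = μ := by
  have hs := (conv_character_eq_iff φ ψ counit).1 h
  rw [genSeries_counit] at hs
  have hμ : ∀ μ : TV ι →ₗ[ℂ] ℂ,
      genSeries (conv (conv μ φ.toLinearMap) ψ.toLinearMap) = genSeries μ := fun μ => by
    rw [genSeries_conv, genSeries_conv, substShifted_mul, substShifted_substShifted _ _ hs,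
      ← mul_assoc, hs, one_mul]
  simp only [conv_eq_comp_rightTranslate] at hμ ⊢
  -- This takes the place of coassociativity: both sides are algebra morphisms, and on words they
  -- agree because linear forms separate points.
  have hid : (rightTranslate φ).comp (rightTranslate ψ) = AlgHom.id ℂ (TV ι) := by
    refine algHom_ext fun w => ?_
    rw [← sub_eq_zero, ← Module.forall_dual_apply_eq_zero_iff ℂ]
    intro μ
    rw [map_sub, sub_eq_zero]
    exact congrFun (hμ μ) w
  ext t
  exact congrArg μ (DFunLike.congr_fun hid t)

end WordHopf

end

/-! ### The proposition -/

theorem proposition6p3 {ι : Type*} {B : Type*} [Ring B] [Algebra ℂ B]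
    (φ : B →ₗ[ℂ] ℂ) (hφ : φ 1 = 1) (b : ι → B)
    (Φ : WordHopf.TV ι →ₐ[ℂ] ℂ) (hΦ : Φ = WordHopf.momentCharacter φ b) :
    ∃ (Φinv : WordHopf.TV ι →ₐ[ℂ] ℂ) (κ β : WordHopf.TV ι →ₗ[ℂ] ℂ),
      -- `Φinv` is the convolution inverse of `Φ`
      (∀ ψ : WordHopf.TV ι →ₗ[ℂ] ℂ,
        WordHopf.IsConvInverse Φ.toLinearMap ψ ↔ ψ = Φinv.toLinearMap) ∧
      -- `κ` is the infinitesimal character of free cumulants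
      (∀ κ' : WordHopf.TV ι →ₗ[ℂ] ℂ, WordHopf.IsFreeCumulants Φ.toLinearMap κ' ↔ κ' = κ) ∧
      -- `β` is the infinitesimal character of Boolean cumulants
      (∀ β' : WordHopf.TV ι →ₗ[ℂ] ℂ, WordHopf.IsBooleanCumulants Φ.toLinearMap β' ↔ β' = β) ∧
      -- (i)
      (WordHopf.genSeries Φinv.toLinearMap * (1 + WordHopf.genSeries κ) = 1 ∧
        (1 + WordHopf.genSeries κ) * WordHopf.genSeries Φinv.toLinearMap = 1) ∧
      -- (ii)
      WordHopf.genSeries β =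
        1 - NCPowerSeries.subst
          (NCPowerSeries.shiftedVars (WordHopf.genSeries Φ.toLinearMap))
          (WordHopf.genSeries Φinv.toLinearMap) := by
  obtain ⟨k, hk, hkg, hgk⟩ :=
    NCPowerSeries.exists_inverse _ (WordHopf.genSeries_character_nil Φ)
  set g := WordHopf.genSeries Φ.toLinearMap with hg
  have hinj : Function.Injective (NCPowerSeries.substShifted g) :=
    Function.LeftInverse.injective (NCPowerSeries.unsubst_substShifted g k hkg)
  -- The series of the inverse, the solution of `f(xg(x)) = k`.
  obtain ⟨f, hf⟩ : ∃ f, f = NCPowerSeries.unsubst k k := ⟨_, rfl⟩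
  -- The series `1 + κ̂`, the solution of `u(xg(x)) = g`.
  obtain ⟨u, hu⟩ : ∃ u, u = NCPowerSeries.unsubst k g := ⟨_, rfl⟩
  have hf₁ : f [] = 1 := by rw [hf, NCPowerSeries.unsubst_nil, hk]
  have hu₁ : (u - 1) [] = 0 := by
    rw [NCPowerSeries.sub_apply, hu, NCPowerSeries.unsubst_nil, NCPowerSeries.one_nil,
      hg, WordHopf.genSeries_character_nil, sub_self]
  have hk₁ : (1 - k) [] = 0 := by
    rw [NCPowerSeries.sub_apply, hk, NCPowerSeries.one_nil, sub_self]
  have hfs : NCPowerSeries.substShifted g f = k := by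
    rw [hf, NCPowerSeries.substShifted_unsubst g k hgk]
  have hus : NCPowerSeries.substShifted g u = g := by
    rw [hu, NCPowerSeries.substShifted_unsubst g k hgk]
  have hF := WordHopf.genSeries_ofSeries hf₁
  have hU := WordHopf.genSeries_infinitesimal hu₁
  have hB := WordHopf.genSeries_infinitesimal hk₁
  have hleft : WordHopf.conv (WordHopf.ofSeries f).toLinearMap Φ.toLinearMap =
      WordHopf.counit.toLinearMap := by
    rw [WordHopf.conv_character_eq_iff, ← hg, hF, hfs, hgk, WordHopf.genSeries_counit]
  have hright : WordHopf.conv Φ.toLinearMap (WordHopf.ofSeries f).toLinearMap =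
      WordHopf.counit.toLinearMap := by
    rw [WordHopf.conv_character_eq_iff, ← hg, hF, WordHopf.genSeries_counit]
    -- After substituting `xg(x)`, the claim `f * g(xf(x)) = 1` becomes `k * g = 1`, because `g *
    -- f(xg(x)) = 1` makes the two substitutions cancel.
    apply hinj
    rw [NCPowerSeries.substShifted_mul,
      NCPowerSeries.substShifted_substShifted g f (by rw [hfs, hgk]), hfs, hkg,
      NCPowerSeries.substShifted_one]
  refine ⟨WordHopf.ofSeries f, WordHopf.infinitesimal (u - 1), WordHopf.infinitesimal (1 - k),
    fun ψ => ⟨fun h => ?_, ?_⟩, fun κ' => ⟨fun h => ?_, ?_⟩, fun β' => ⟨fun h => ?_, ?_⟩,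
    ⟨?_, ?_⟩, ?_⟩
  -- Both `ψ` and the constructed inverse equal `ε * Φ⁻¹`; only the left inverse property of `ψ`
  -- enters.
  · rw [← WordHopf.conv_conv_cancel hright ψ, h.2, ← hleft,
      WordHopf.conv_conv_cancel hright]
  · rintro rfl
    exact ⟨hright, hleft⟩
  · refine h.1.ext_genSeries (WordHopf.isInfinitesimalCharacter_infinitesimal _) ?_
    rw [hU, eq_sub_iff_add_eq']
    apply hinj
    rw [hus, ← (WordHopf.isFreeCumulants_iff h.1 Φ).1 h]
  · rintro rfl
    rw [WordHopf.isFreeCumulants_iff (WordHopf.isInfinitesimalCharacter_infinitesimal _), hU,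
      ← hg, add_sub_cancel, hus]
  · refine h.1.ext_genSeries (WordHopf.isInfinitesimalCharacter_infinitesimal _) ?_
    -- Multiplying `g = 1 + β̂ g` by `k` on the right gives `1 = k + β̂`.
    have hb := congrArg (· * k) ((WordHopf.isBooleanCumulants_iff h.1 Φ).1 h)
    simp only [← hg, add_mul, mul_assoc, hgk, one_mul, mul_one] at hb
    rw [hB, hb, add_sub_cancel_left]
  · rintro rfl
    rw [WordHopf.isBooleanCumulants_iff (WordHopf.isInfinitesimalCharacter_infinitesimal _), hB,
      ← hg, sub_mul, hkg, one_mul, add_sub_cancel]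
  · rw [hF, hU, add_sub_cancel]
    apply hinj
    rw [NCPowerSeries.substShifted_mul, hfs, hus, hkg, NCPowerSeries.substShifted_one]
  · rw [hF, hU, add_sub_cancel]
    apply hinj
    rw [NCPowerSeries.substShifted_mul, hfs, hus, hgk, NCPowerSeries.substShifted_one]
  · rw [hF, hB, ← hfs]
    rfl
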